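/- Let $n\ge 1$, let $A,B,C\in\mathbb{C}^{n\times n}$, and let $\star$ denote either the transpose or the conjugate transpose. The spectrum $\sigma(M-\lambda N)$ of a pencil of $n\times n$ matrices is the set of $\lambda\in\mathbb{C}$ with $\det(M-\lambda N)=0$, together with $\infty$ if $\det N=0$. If $\sigma(A^\star-\lambda B)$ lies strictly inside the unit circle, a solution $X$ of $AX+X^\star B=C$ is called stabilizing. Put $K_{12}=\tfrac12(-A^\star+B)$, $K_{22}=\tfrac12(-C^\star+C)$, $H_{12}^{(0)}=\tfrac12(A^\star+B)$, $H_{22}^{(0)}=\tfrac12(C^\star+C)$. The palindromic doubling algorithm computes, for $k=0,1,2,\dots$, $$T_k=(H_{12}^{(k)})^{-1}K_{12},\qquad H_{12}^{(k+1)}=\tfrac12\bigl(H_{12}^{(k)}+K_{12}T_k\bigr),$$ $$H_{22}^{(k+1)}=\tfrac12\bigl(H_{22}^{(k)}+T_k^\star H_{22}^{(k)}T_k+K_{22}T_k-T_k^\star K_{22}\bigr).$$ Let $Z_{12}^{(k)}$ and $Z_{21}^{(k)}$ be the off-diagonal $n\times n$ blocks of $$\mathcal{Z}_k=\begin{bmatrix}0&H_{12}^{(k)}\\(H_{12}^{(k)})^\star&-H_{22}^{(k)}\end{bmatrix}+\begin{bmatrix}0&K_{12}\\-K_{12}^\star&-K_{22}\end{bmatrix}=\begin{bmatrix}0&Z_{12}^{(k)}\\Z_{21}^{(k)}&-Z_{22}^{(k)}\end{bmatrix},$$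 and let $X_k=(H_{12}^{(k)}+K_{12})^{-\star}(H_{22}^{(k)}+K_{22})^\star$. **Theorem.** Suppose that $\sigma(A-\lambda B^\star)$ lies strictly inside the unit circle, and let $X$ be the stabilizing solution of $AX+X^\star B=C$. Then all iterates are well defined: $H_{12}^{(k)}$ and $H_{12}^{(k)}+K_{12}$ are nonsingular for every $k\ge 0$. Moreover the maximum $\rho=\max\{|\tau|:\tau\in\sigma(A-\lambda B^\star)\}$ exists, $\rho<1$, and $$Z_{12}^{(k)}\to -A^\star+B,\qquad Z_{21}^{(k)}\to 0,\qquad X_k\to X\qquad(k\to\infty)$$ quadratically with convergence rate $\rho$. Here $Y_k\to L$ quadratically with convergence rate $\rho$ means that, for any given norm $\|\cdot\|$ on $\mathbb{C}^{n\times n}$, $Y_k\to L$, there is a constant $c$ with $\|Y_{k+1}-L\|\le c\,\|Y_k-L\|^2$ for all $k\ge 0$, and $\limsup_{k\to\infty}\|Y_k-L\|^{1/2^k}\le\rho$. -/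

import Mathlib

open Matrix Filter Topology

namespace Palindromic

/-- The two meanings of the superscript `⋆`: transpose or conjugate transpose. -/
inductive StarKind where
  | transpose
  | conjTranspose

/-- `s.op M` is `M^⋆`, that is `Mᵀ` or `Mᴴ` according to `s`. -/
def StarKind.op {m n : Type*} (s : StarKind) (M : Matrix m n ℂ) : Matrix n m ℂ :=
  match s with
  | .transpose => Mᵀ
  | .conjTranspose => Mᴴ

section Defs

variable {n : ℕ}

/-- The spectrum `σ(A - λ B)` of a matrix pencil, in the extended complex plane: the finite
eigenvalues are the roots of `det (A - λ B)`, and `∞` is an eigenvalue iff `B` is singular.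
A singular pencil (`det (A - λ B) = 0` for all `λ`) has every point in its spectrum. -/
def pencilSpectrum (A B : Matrix (Fin n) (Fin n) ℂ) : Set (OnePoint ℂ) :=
  {τ | (τ = OnePoint.infty ∧ B.det = 0) ∨ ∃ l : ℂ, τ = (l : OnePoint ℂ) ∧ (A - l • B).det = 0}

/-- A set of extended complex numbers lies (strictly) inside the unit circle. -/
def InsideUnitCircle (S : Set (OnePoint ℂ)) : Prop :=
  ∀ τ ∈ S, ∃ l : ℂ, τ = (l : OnePoint ℂ) ∧ ‖l‖ < 1

/-- The set of moduli of the finite points of `S`. -/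
def moduli (S : Set (OnePoint ℂ)) : Set ℝ :=
  {r | ∃ l : ℂ, (l : OnePoint ℂ) ∈ S ∧ r = ‖l‖}

/-- `X` is a stabilizing solution of `A X + X^⋆ B = C`. -/
def IsStabilizingSolution (s : StarKind) (A B C X : Matrix (Fin n) (Fin n) ℂ) : Prop :=
  InsideUnitCircle (pencilSpectrum (s.op A) B) ∧ A * X + s.op X * B = C

/-- `K₁₂ = (-A^⋆ + B) / 2`. -/
noncomputable def K12 (s : StarKind) (A B : Matrix (Fin n) (Fin n) ℂ) :
    Matrix (Fin n) (Fin n) ℂ :=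
  (1 / 2 : ℂ) • (-s.op A + B)

/-- `K₂₂ = (-C^⋆ + C) / 2`. -/
noncomputable def K22 (s : StarKind) (C : Matrix (Fin n) (Fin n) ℂ) :
    Matrix (Fin n) (Fin n) ℂ :=
  (1 / 2 : ℂ) • (-s.op C + C)

/-- The iterates `H₁₂^{(k)}` of the palindromic doubling algorithm; the step is
`H₁₂^{(k+1)} = (H₁₂^{(k)} + K₁₂ T_k) / 2` with `T_k = (H₁₂^{(k)})⁻¹ K₁₂`. -/
noncomputable def H12 (s : StarKind) (A B : Matrix (Fin n) (Fin n) ℂ) :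
    ℕ → Matrix (Fin n) (Fin n) ℂ
  | 0 => (1 / 2 : ℂ) • (s.op A + B)
  | k + 1 => (1 / 2 : ℂ) • (H12 s A B k + K12 s A B * ((H12 s A B k)⁻¹ * K12 s A B))

/-- `T_k = (H₁₂^{(k)})⁻¹ K₁₂`. -/
noncomputable def Tk (s : StarKind) (A B : Matrix (Fin n) (Fin n) ℂ) (k : ℕ) :
    Matrix (Fin n) (Fin n) ℂ :=
  (H12 s A B k)⁻¹ * K12 s A B

/-- The iterates `H₂₂^{(k)}` of the palindromic doubling algorithm. -/
noncomputable def H22 (s : StarKind) (A B C : Matrix (Fin n) (Fin n) ℂ) :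
    ℕ → Matrix (Fin n) (Fin n) ℂ
  | 0 => (1 / 2 : ℂ) • (s.op C + C)
  | k + 1 => (1 / 2 : ℂ) •
      (H22 s A B C k + s.op (Tk s A B k) * H22 s A B C k * Tk s A B k
        + K22 s C * Tk s A B k - s.op (Tk s A B k) * K22 s C)

/-- The block matrix `𝒦`. -/
noncomputable def blockK (s : StarKind) (A B C : Matrix (Fin n) (Fin n) ℂ) :
    Matrix (Fin n ⊕ Fin n) (Fin n ⊕ Fin n) ℂ :=
  fromBlocks 0 (K12 s A B) (-s.op (K12 s A B)) (-K22 s C)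

/-- The block matrix `ℋ_k`. -/
noncomputable def blockH (s : StarKind) (A B C : Matrix (Fin n) (Fin n) ℂ) (k : ℕ) :
    Matrix (Fin n ⊕ Fin n) (Fin n ⊕ Fin n) ℂ :=
  fromBlocks 0 (H12 s A B k) (s.op (H12 s A B k)) (-H22 s A B C k)

/-- `𝒵_k = ℋ_k + 𝒦`. -/
noncomputable def blockZ (s : StarKind) (A B C : Matrix (Fin n) (Fin n) ℂ) (k : ℕ) :
    Matrix (Fin n ⊕ Fin n) (Fin n ⊕ Fin n) ℂ :=
  blockH s A B C k + blockK s A B C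

/-- `Z₁₂^{(k)}`, the upper right block of `𝒵_k`. -/
noncomputable def Z12 (s : StarKind) (A B C : Matrix (Fin n) (Fin n) ℂ) (k : ℕ) :
    Matrix (Fin n) (Fin n) ℂ :=
  (blockZ s A B C k).toBlocks₁₂

/-- `Z₂₁^{(k)}`, the lower left block of `𝒵_k`. -/
noncomputable def Z21 (s : StarKind) (A B C : Matrix (Fin n) (Fin n) ℂ) (k : ℕ) :
    Matrix (Fin n) (Fin n) ℂ :=
  (blockZ s A B C k).toBlocks₂₁

/-- `X_k = (H₁₂^{(k)} + K₁₂)^{-⋆} (H₂₂^{(k)} + K₂₂)^⋆`. -/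
noncomputable def Xk (s : StarKind) (A B C : Matrix (Fin n) (Fin n) ℂ) (k : ℕ) :
    Matrix (Fin n) (Fin n) ℂ :=
  (s.op (H12 s A B k + K12 s A B))⁻¹ * s.op (H22 s A B C k + K22 s C)

/-- `Y_k → L` quadratically with convergence rate `ρ`, measured in the norm `N`:
`Y_k → L`, `N (Y_{k+1} - L) ≤ c N (Y_k - L)²` for a constant `c`, and
`limsup N (Y_k - L)^{1/2^k} ≤ ρ` (the limsup is taken in the extended reals). -/
def ConvergesQuadratically (N : Seminorm ℂ (Matrix (Fin n) (Fin n) ℂ))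
    (Y : ℕ → Matrix (Fin n) (Fin n) ℂ) (L : Matrix (Fin n) (Fin n) ℂ) (ρ : ℝ) : Prop :=
  Tendsto Y atTop (𝓝 L) ∧
  (∃ c : ℝ, ∀ k, N (Y (k + 1) - L) ≤ c * N (Y k - L) ^ 2) ∧
  limsup (fun k : ℕ => ((N (Y k - L) ^ (1 / 2 ^ k : ℝ) : ℝ) : EReal)) atTop ≤ (ρ : EReal)

end Defs

end Palindromic

open Palindromic

/-! Put `S = B⁻¹ A^⋆` and `R = S ^ 2 ^ k`; the spectrum of `S` lies in the open unit disc. The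
iteration is a Cayley transform in disguise: `H₁₂ (1 - R) = K₁₂ (1 + R)`, and one step squares `R`
(`H12_mul_one_sub_pow`). Hence `H₁₂ + K₁₂ = D (1 - R)⁻¹` and `H₁₂ - K₁₂ = D R (1 - R)⁻¹` with `D = 2
K₁₂` invertible. The equation for `X` gives `H₂₂ = X^⋆ H₁₂ + H₁₂^⋆ X` (`H22_eq`), so the error of
`X_k` is `(H₁₂ + K₁₂)^{-⋆} X^⋆ (H₁₂ - K₁₂)` (`Xk_sub`). As `1 - R` and its inverse stay bounded,
each error is bounded above and below by multiples of `‖D R‖` or `‖X^⋆ D R‖`. Gelfand's formula then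
gives the rate `ρ`, and `exists_norm_mul_pow_two_mul_le` the quadratic estimate, even if `X` is
singular. -/

namespace Palindromic

/-! ### Algebra of the star operation -/

section Op

variable {n : ℕ} (s : StarKind)

theorem StarKind.op_op (M : Matrix (Fin n) (Fin n) ℂ) : s.op (s.op M) = M := by
  cases s <;> simp [StarKind.op]

theorem StarKind.op_add (M N : Matrix (Fin n) (Fin n) ℂ) :
    s.op (M + N) = s.op M + s.op N := by
  cases s <;> simp [StarKind.op]

theorem StarKind.op_sub (M N : Matrix (Fin n) (Fin n) ℂ) :
    s.op (M - N) = s.op M - s.op N := by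
  cases s <;> simp [StarKind.op]

theorem StarKind.op_mul (M N : Matrix (Fin n) (Fin n) ℂ) :
    s.op (M * N) = s.op N * s.op M := by
  cases s <;> simp [StarKind.op]

theorem StarKind.op_one : s.op (1 : Matrix (Fin n) (Fin n) ℂ) = 1 := by
  cases s <;> simp [StarKind.op]

theorem StarKind.op_half_smul (M : Matrix (Fin n) (Fin n) ℂ) :
    s.op ((1 / 2 : ℂ) • M) = (1 / 2 : ℂ) • s.op M := by
  cases s <;> simp [StarKind.op, conjTranspose_smul]

theorem StarKind.isUnit_op {M : Matrix (Fin n) (Fin n) ℂ} (h : IsUnit M) :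
    IsUnit (s.op M) := by
  cases s
  · exact (M.isUnit_transpose).2 h
  · exact (M.isUnit_conjTranspose).2 h

theorem StarKind.det_op_eq_zero_iff (M : Matrix (Fin n) (Fin n) ℂ) :
    (s.op M).det = 0 ↔ M.det = 0 := by
  cases s <;> simp [StarKind.op, det_conjTranspose]

/-- The action of `⋆` on scalars. -/
noncomputable def StarKind.scalar (s : StarKind) (l : ℂ) : ℂ :=
  match s with
  | .transpose => l
  | .conjTranspose => star l

theorem StarKind.scalar_scalar (l : ℂ) : s.scalar (s.scalar l) = l := by
  cases s <;> simp [StarKind.scalar]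

theorem StarKind.norm_scalar (l : ℂ) : ‖s.scalar l‖ = ‖l‖ := by
  cases s <;> simp [StarKind.scalar]

theorem StarKind.op_smul (l : ℂ) (M : Matrix (Fin n) (Fin n) ℂ) :
    s.op (l • M) = s.scalar l • s.op M := by
  cases s <;> simp [StarKind.op, StarKind.scalar, conjTranspose_smul]

end Op

/-! ### Pencil spectra as matrix spectra -/

section Pencil

variable {n : ℕ}

theorem det_ne_zero_of_insideUnitCircle {P B : Matrix (Fin n) (Fin n) ℂ}
    (h : InsideUnitCircle (pencilSpectrum P B)) : B.det ≠ 0 := by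
  intro hB
  obtain ⟨l, hl, -⟩ := h OnePoint.infty (Or.inl ⟨rfl, hB⟩)
  exact OnePoint.infty_ne_coe l hl

theorem coe_mem_pencilSpectrum {P B : Matrix (Fin n) (Fin n) ℂ} {l : ℂ} :
    (l : OnePoint ℂ) ∈ pencilSpectrum P B ↔ (P - l • B).det = 0 := by
  constructor
  · rintro (⟨h, -⟩ | ⟨m, hm, h⟩)
    · exact absurd h (OnePoint.coe_ne_infty l)
    · rwa [OnePoint.coe_injective hm]
  · exact fun h => Or.inr ⟨l, rfl, h⟩

theorem norm_lt_one_of_insideUnitCircle {P B : Matrix (Fin n) (Fin n) ℂ}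
    (h : InsideUnitCircle (pencilSpectrum P B)) {l : ℂ} (hl : (P - l • B).det = 0) :
    ‖l‖ < 1 := by
  obtain ⟨m, hm, hm'⟩ := h l (coe_mem_pencilSpectrum.2 hl)
  rwa [OnePoint.coe_injective hm]

theorem det_pencil_eq_zero_iff {P B : Matrix (Fin n) (Fin n) ℂ} (hB : B.det ≠ 0) (l : ℂ) :
    (P - l • B).det = 0 ↔ l ∈ spectrum ℂ (B⁻¹ * P) := by
  have e : P - l • B = -(B * (algebraMap ℂ _ l - B⁻¹ * P)) := by
    rw [mul_sub, mul_nonsing_inv_cancel_left _ _ (isUnit_iff_ne_zero.2 hB),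
      Algebra.algebraMap_eq_smul_one, mul_smul_comm, mul_one, neg_sub]
  rw [spectrum.mem_iff, isUnit_iff_isUnit_det, isUnit_iff_ne_zero, not_not, e, det_neg, det_mul]
  simp [hB]

/-- Applying `⋆` to `A - l B^⋆` gives `A^⋆ - l' B`, where `l'` is `l` or its conjugate. -/
theorem moduli_pencilSpectrum_op (s : StarKind) (A B : Matrix (Fin n) (Fin n) ℂ) :
    moduli (pencilSpectrum A (s.op B)) = moduli (pencilSpectrum (s.op A) B) := by
  have key : ∀ l, (A - l • s.op B).det = 0 ↔ (s.op A - s.scalar l • B).det = 0 := by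
    intro l
    rw [← s.det_op_eq_zero_iff, s.op_sub, s.op_smul, s.op_op]
  ext r
  simp only [moduli, Set.mem_ofPred_eq, coe_mem_pencilSpectrum]
  constructor
  · rintro ⟨l, hl, rfl⟩
    exact ⟨s.scalar l, (key l).1 hl, (s.norm_scalar l).symm⟩
  · rintro ⟨l, hl, rfl⟩
    exact ⟨s.scalar l, (key _).2 (by rwa [s.scalar_scalar]), (s.norm_scalar l).symm⟩

end Pencil

/-! ### Closed forms for the iterates -/

section Iterates

variable {n : ℕ} {s : StarKind} {A B C X S : Matrix (Fin n) (Fin n) ℂ}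

/-- The step averages `K (1 + R)(1 - R)⁻¹` with `K (1 - R)(1 + R)⁻¹`, which replaces `R` by `R²`.
The form without inverses also yields invertibility of `H₁₂`, a left factor of the invertible `K (1
+ R)`. -/
theorem H12_mul_one_sub_pow (hS : B * S = s.op A)
    (hadd : ∀ k : ℕ, IsUnit (1 + S ^ 2 ^ k))
    (hK : IsUnit (K12 s A B)) (k : ℕ) :
    H12 s A B k * (1 - S ^ 2 ^ k) = K12 s A B * (1 + S ^ 2 ^ k) ∧ IsUnit (H12 s A B k) := by
  have unit_of : ∀ k : ℕ, H12 s A B k * (1 - S ^ 2 ^ k) = K12 s A B * (1 + S ^ 2 ^ k) →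
      IsUnit (H12 s A B k) := by
    intro k h
    have := hK.mul (hadd k)
    rw [← h] at this
    rw [isUnit_iff_isUnit_det, det_mul] at this
    exact (isUnit_iff_isUnit_det _).2 (isUnit_of_mul_isUnit_left this)
  induction k with
  | zero =>
    have h : H12 s A B 0 * (1 - S ^ 2 ^ 0) = K12 s A B * (1 + S ^ 2 ^ 0) := by
      simp only [H12, K12, ← hS, pow_zero, pow_one, smul_mul_assoc]
      congr 1
      noncomm_ring
    exact ⟨h, unit_of 0 h⟩
  | succ k ih =>
    obtain ⟨h, hu⟩ := ih
    have hT : ((H12 s A B k)⁻¹ * K12 s A B) * (1 + S ^ 2 ^ k) = 1 - S ^ 2 ^ k := by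
      rw [mul_assoc, ← h, nonsing_inv_mul_cancel_left _ _ ((isUnit_iff_isUnit_det _).1 hu)]
    have h' : H12 s A B (k + 1) * (1 - S ^ 2 ^ (k + 1)) =
        K12 s A B * (1 + S ^ 2 ^ (k + 1)) := by
      have e : S ^ 2 ^ (k + 1) = S ^ 2 ^ k * S ^ 2 ^ k := by rw [← pow_add]; congr 1; ring
      rw [e]
      generalize S ^ 2 ^ k = R at h hT
      have e1 : (1 : Matrix (Fin n) (Fin n) ℂ) - R * R = (1 - R) * (1 + R) := by noncomm_ring
      have e2 : (1 : Matrix (Fin n) (Fin n) ℂ) - R * R = (1 + R) * (1 - R) := by noncomm_ring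
      have e3 : (1 + R) * (1 + R) + (1 - R) * (1 - R) = (2 : ℂ) • (1 + R * R) := by
        rw [two_smul]; noncomm_ring
      calc H12 s A B (k + 1) * (1 - R * R)
          = (1 / 2 : ℂ) • (H12 s A B k * (1 - R * R)
            + K12 s A B * (((H12 s A B k)⁻¹ * K12 s A B) * (1 - R * R))) := by
            simp only [H12, smul_mul_assoc, add_mul, mul_assoc]
        _ = (1 / 2 : ℂ) • (K12 s A B * ((1 + R) * (1 + R) + (1 - R) * (1 - R))) := by
            congr 1
            rw [mul_add]
            congr 1
            · rw [e1, ← mul_assoc, h, mul_assoc]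
            · rw [e2, ← mul_assoc _ (1 + R), hT]
        _ = K12 s A B * (1 + R * R) := by
            rw [e3, mul_smul_comm, smul_smul]; norm_num
    exact ⟨h', unit_of _ h'⟩

theorem op_rhs_eq (hX : A * X + s.op X * B = C) :
    s.op C = s.op X * s.op A + s.op B * X := by
  rw [← hX, s.op_add, s.op_mul, s.op_mul, s.op_op]

theorem K22_eq (hX : A * X + s.op X * B = C) :
    K22 s C = s.op X * K12 s A B - s.op (K12 s A B) * X := by
  have e : -s.op A + B = B - s.op A := by abel
  simp only [K22, K12, op_rhs_eq hX, e, s.op_half_smul, s.op_sub, s.op_op, mul_smul_comm,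
    smul_mul_assoc]
  rw [← smul_sub, ← hX]
  congr 1
  noncomm_ring

/-- The recursion for `H₂₂` preserves this form, since `H T = K` turns the congruence term `T^⋆ H₂₂
T` into `T^⋆ X^⋆ K + K^⋆ X T`, whose unwanted parts cancel against the `K₂₂` terms. -/
theorem H22_eq (hX : A * X + s.op X * B = C) (hH : ∀ k, IsUnit (H12 s A B k)) (k : ℕ) :
    H22 s A B C k = s.op X * H12 s A B k + s.op (H12 s A B k) * X := by
  induction k with
  | zero =>
    simp only [H22, H12, op_rhs_eq hX, s.op_half_smul, s.op_add, s.op_op, mul_smul_comm, smul_mul_assoc]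
    rw [← smul_add, ← hX]
    congr 1
    noncomm_ring
  | succ k ih =>
    have hT : H12 s A B k * Tk s A B k = K12 s A B :=
      mul_nonsing_inv_cancel_left _ _ ((isUnit_iff_isUnit_det _).1 (hH k))
    have hT' : s.op (Tk s A B k) * s.op (H12 s A B k) = s.op (K12 s A B) := by
      rw [← s.op_mul, hT]
    have e : H12 s A B (k + 1) = (1 / 2 : ℂ) • (H12 s A B k + K12 s A B * Tk s A B k) := rfl
    rw [H22, e, ih, K22_eq hX]
    simp only [s.op_half_smul, s.op_add, s.op_mul, mul_smul_comm, smul_mul_assoc]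
    rw [← smul_add]
    congr 1
    generalize Tk s A B k = T at *
    generalize H12 s A B k = H at *
    have e1 : s.op T * (s.op X * H + s.op H * X) * T =
        s.op T * s.op X * K12 s A B + s.op (K12 s A B) * X * T := by
      rw [← hT', ← hT]; noncomm_ring
    rw [e1]
    noncomm_ring

theorem Z12_eq (k : ℕ) : Z12 s A B C k = H12 s A B k + K12 s A B := rfl

theorem Z21_eq (k : ℕ) : Z21 s A B C k = s.op (H12 s A B k - K12 s A B) := by
  rw [s.op_sub, sub_eq_add_neg]; rfl

theorem Xk_sub (hX : A * X + s.op X * B = C) (hH : ∀ k, IsUnit (H12 s A B k)) (k : ℕ)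
    (hu : IsUnit (H12 s A B k + K12 s A B)) :
    Xk s A B C k - X =
      (s.op (H12 s A B k + K12 s A B))⁻¹ * (s.op X * (H12 s A B k - K12 s A B)) := by
  have hU := (isUnit_iff_isUnit_det _).1 (s.isUnit_op hu)
  have e : s.op (H22 s A B C k + K22 s C) =
      s.op (H12 s A B k + K12 s A B) * X + s.op X * (H12 s A B k - K12 s A B) := by
    rw [H22_eq hX hH, K22_eq hX]
    simp only [s.op_add, s.op_sub, s.op_mul, s.op_op]
    noncomm_ring
  rw [Xk, e, mul_add, nonsing_inv_mul_cancel_left _ _ hU, add_sub_cancel_left]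

end Iterates

/-! ### Norm estimates and Gelfand's formula -/

/-- `Y` need not be invertible, so `S ^ m` cannot be bounded by `Y * S ^ m`. Instead pick `p` in the
algebra generated by `S`, linearly in `Y * S ^ m`, with `Y p = Y S ^ m`; since `p` commutes with `S
^ m`, `Y S ^ (2m) = Y p S ^ m = Y S ^ m p`. -/
theorem exists_norm_mul_pow_two_mul_le {R : Type*} [NormedRing R] [NormedAlgebra ℂ R]
    [FiniteDimensional ℂ R] (Y S : R) :
    ∃ c : ℝ, ∀ m : ℕ, ‖Y * S ^ (2 * m)‖ ≤ c * ‖Y * S ^ m‖ ^ 2 := by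
  let f : Algebra.adjoin ℂ {S} →ₗ[ℂ] R :=
    LinearMap.mulLeft ℂ Y ∘ₗ (Algebra.adjoin ℂ {S}).val.toLinearMap
  -- The linear section `g` selects `p`; its extension `G` to all of `R` is bounded by finite
  -- dimension.
  obtain ⟨g, hg⟩ := LinearMap.exists_rightInverse_of_surjective f.rangeRestrict
    f.range_rangeRestrict
  obtain ⟨G, hG⟩ := LinearMap.exists_extend ((Algebra.adjoin ℂ {S}).val.toLinearMap ∘ₗ g)
  refine ⟨‖LinearMap.toContinuousLinearMap G‖, fun m => ?_⟩
  have hmem : S ^ m ∈ Algebra.adjoin ℂ {S} :=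
    Subalgebra.pow_mem _ (Algebra.self_mem_adjoin_singleton ℂ S) m
  let z : LinearMap.range f := ⟨Y * S ^ m, ⟨S ^ m, hmem⟩, rfl⟩
  have hGz : G (Y * S ^ m) = (g z : R) := LinearMap.congr_fun hG z
  have hYg : Y * (g z : R) = Y * S ^ m :=
    congrArg (Subtype.val : LinearMap.range f → R) (LinearMap.congr_fun hg z)
  have hcomm : Commute (g z : R) (S ^ m) :=
    (Algebra.commute_of_mem_adjoin_self (g z).2).symm.pow_right m
  have hbound : ‖(g z : R)‖ ≤ ‖LinearMap.toContinuousLinearMap G‖ * ‖Y * S ^ m‖ := by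
    rw [← hGz]
    exact (LinearMap.toContinuousLinearMap G).le_opNorm _
  calc ‖Y * S ^ (2 * m)‖ = ‖Y * S ^ m * (g z : R)‖ := by
        rw [two_mul, pow_add, ← mul_assoc, ← hYg, mul_assoc, hcomm.eq, ← mul_assoc, hYg]
    _ ≤ ‖Y * S ^ m‖ * (‖LinearMap.toContinuousLinearMap G‖ * ‖Y * S ^ m‖) :=
        (norm_mul_le _ _).trans (by gcongr)
    _ = _ := by ring

theorem exists_seminorm_le_and_norm_le {E : Type*} [NormedAddCommGroup E] [NormedSpace ℂ E]
    [FiniteDimensional ℂ E] (N : Seminorm ℂ E) (hN : ∀ x, N x = 0 → x = 0) :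
    ∃ a > 0, ∃ b > 0, (∀ x, N x ≤ a * ‖x‖) ∧ ∀ x, ‖x‖ ≤ b * N x := by
  let _ : NormedSpace ℝ E := NormedSpace.restrictScalars ℝ ℂ E
  have : IsScalarTower ℝ ℂ E := Real.isScalarTower
  have : FiniteDimensional ℝ E := FiniteDimensional.complexToReal E
  have hcont : Continuous N := (N.convexOn.locallyLipschitz).continuous
  have : ProperSpace E := FiniteDimensional.proper ℂ E
  obtain ⟨a, ha, hNa⟩ := Seminorm.bound_of_continuous_normedSpace N hcont
  refine ⟨a, ha, ?_⟩
  -- The unit sphere is empty exactly when `E` is trivial.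
  rcases (Metric.sphere (0 : E) 1).eq_empty_or_nonempty with he | hne
  · refine ⟨1, one_pos, hNa, fun x => ?_⟩
    have hx : x = 0 := by
      by_contra hx
      have : ((‖x‖⁻¹ : ℝ) : ℂ) • x ∈ Metric.sphere (0 : E) 1 := by
        simp [norm_smul, hx]
      simp [he] at this
    simp [hx]
  · obtain ⟨y, hy, hmin⟩ := (isCompact_sphere (0 : E) 1).exists_isMinOn hne hcont.continuousOn
    have hy1 : ‖y‖ = 1 := by simpa using hy
    have hpos : 0 < N y := lt_of_le_of_ne (apply_nonneg N y) fun h => by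
      simp [hN y h.symm] at hy1
    refine ⟨(N y)⁻¹, inv_pos.2 hpos, hNa, fun x => ?_⟩
    rcases eq_or_ne x 0 with rfl | hx
    · simp
    have hxn : 0 < ‖x‖ := norm_pos_iff.2 hx
    have hmem : ((‖x‖⁻¹ : ℝ) : ℂ) • x ∈ Metric.sphere (0 : E) 1 := by
      simp [norm_smul, hx]
    have h1 : N y ≤ N (((‖x‖⁻¹ : ℝ) : ℂ) • x) := hmin hmem
    rw [map_smul_eq_mul, Complex.norm_real, norm_inv, norm_norm] at h1
    rw [inv_mul_eq_div, le_div_iff₀ hpos]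
    calc ‖x‖ * N y ≤ ‖x‖ * (‖x‖⁻¹ * N x) := by gcongr
      _ = N x := by field_simp

theorem tendsto_norm_pow_two_pow_rpow {R : Type*} [NormedRing R] [NormedAlgebra ℂ R]
    [CompleteSpace R] (S : R) {ρ : ℝ} (hρ : 0 ≤ ρ)
    (hS : spectralRadius ℂ S = ENNReal.ofReal ρ) :
    Tendsto (fun k : ℕ => ‖S ^ 2 ^ k‖ ^ (1 / 2 ^ k : ℝ)) atTop (𝓝 ρ) := by
  have h := (spectrum.pow_norm_pow_one_div_tendsto_nhds_spectralRadius S).comp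
    (tendsto_pow_atTop_atTop_of_one_lt one_lt_two)
  rw [hS] at h
  have h' := (ENNReal.tendsto_toReal ENNReal.ofReal_ne_top).comp h
  rw [ENNReal.toReal_ofReal hρ] at h'
  refine h'.congr fun k => ?_
  simp only [Function.comp_apply, Nat.cast_pow, Nat.cast_ofNat]
  rw [ENNReal.toReal_ofReal (by positivity)]

theorem tendsto_pow_two_pow_zero {R : Type*} [NormedRing R] [NormedAlgebra ℂ R]
    [CompleteSpace R] (S : R) {ρ : ℝ} (hρ : 0 ≤ ρ) (hρ1 : ρ < 1)
    (hS : spectralRadius ℂ S = ENNReal.ofReal ρ) :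
    Tendsto (fun k : ℕ => S ^ 2 ^ k) atTop (𝓝 0) := by
  obtain ⟨r, hr, hr1⟩ := exists_between hρ1
  rw [tendsto_zero_iff_norm_tendsto_zero]
  have hlim : Tendsto (fun k : ℕ => r ^ 2 ^ k) atTop (𝓝 0) :=
    (tendsto_pow_atTop_nhds_zero_of_lt_one (hρ.trans hr.le) hr1).comp
      (tendsto_pow_atTop_atTop_of_one_lt one_lt_two)
  refine squeeze_zero' (Eventually.of_forall fun _ => norm_nonneg _) ?_ hlim
  filter_upwards [(tendsto_norm_pow_two_pow_rpow S hρ hS).eventually (gt_mem_nhds hr)] with k hk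
  have e : ‖S ^ 2 ^ k‖ = (‖S ^ 2 ^ k‖ ^ (1 / 2 ^ k : ℝ)) ^ 2 ^ k := by
    rw [← Real.rpow_natCast, ← Real.rpow_mul (norm_nonneg _)]
    simp
  rw [e]
  gcongr

/-- By spectral mapping, the spectrum of `S ^ m` avoids the unit circle, in particular `1` and `-1`.
-/
theorem isUnit_one_sub_pow_and_isUnit_one_add_pow {R : Type*} [Ring R] [Algebra ℂ R] {S : R}
    (hS : ∀ l ∈ spectrum ℂ S, ‖l‖ < 1) {m : ℕ} (hm : 0 < m) :
    IsUnit (1 - S ^ m) ∧ IsUnit (1 + S ^ m) := by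
  have key : ∀ z : ℂ, ‖z‖ = 1 → z ∉ spectrum ℂ (S ^ m) := by
    intro z hz hmem
    rw [spectrum.map_pow_of_pos S hm] at hmem
    obtain ⟨l, hl, rfl⟩ := hmem
    rw [norm_pow] at hz
    exact (pow_lt_one₀ (norm_nonneg l) (hS l hl) hm.ne').ne hz
  have h1 := spectrum.notMem_iff.1 (key 1 (by simp))
  have h2 := spectrum.notMem_iff.1 (key (-1) (by simp))
  rw [map_one] at h1
  rw [map_neg, map_one] at h2
  refine ⟨h1, ?_⟩
  have e : (1 : R) + S ^ m = -(-1 - S ^ m) := by abel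
  rw [e]
  exact h2.neg

/-! ### From two-sided bounds to quadratic convergence -/

section Convergence

attribute [local instance] Matrix.frobeniusNormedRing Matrix.frobeniusNormedAlgebra

variable {n : ℕ}

theorem StarKind.norm_op (s : StarKind) (M : Matrix (Fin n) (Fin n) ℂ) : ‖s.op M‖ = ‖M‖ := by
  cases s
  · exact frobenius_norm_transpose M
  · exact frobenius_norm_conjTranspose M

theorem exists_norm_one_sub_pow_le {S : Matrix (Fin n) (Fin n) ℂ}
    (hS : Tendsto (fun k : ℕ => S ^ 2 ^ k) atTop (𝓝 0)) :
    ∃ c : ℝ, 0 ≤ c ∧ ∀ k : ℕ, ‖1 - S ^ 2 ^ k‖ ≤ c ∧ ‖(1 - S ^ 2 ^ k)⁻¹‖ ≤ c := by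
  have h1 : Tendsto (fun k : ℕ => 1 - S ^ 2 ^ k) atTop (𝓝 1) := by
    simpa using tendsto_const_nhds.sub hS
  have h2 : Tendsto (fun k : ℕ => (1 - S ^ 2 ^ k)⁻¹) atTop
      (𝓝 (Ring.inverse (1 : Matrix (Fin n) (Fin n) ℂ))) := by
    simp_rw [nonsing_inv_eq_ringInverse]
    exact (NormedRing.inverse_continuousAt 1).tendsto.comp h1
  obtain ⟨c₁, hc₁⟩ := h1.norm.bddAbove_range
  obtain ⟨c₂, hc₂⟩ := h2.norm.bddAbove_range
  have hk₁ : ∀ k : ℕ, ‖1 - S ^ 2 ^ k‖ ≤ c₁ := fun k => hc₁ ⟨k, rfl⟩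
  have hk₂ : ∀ k : ℕ, ‖(1 - S ^ 2 ^ k)⁻¹‖ ≤ c₂ := fun k => hc₂ ⟨k, rfl⟩
  exact ⟨max c₁ c₂, (norm_nonneg _).trans ((hk₁ 0).trans (le_max_left _ _)), fun k =>
    ⟨(hk₁ k).trans (le_max_left _ _), (hk₂ k).trans (le_max_right _ _)⟩⟩

theorem convergesQuadratically_of_norm_le {N : Seminorm ℂ (Matrix (Fin n) (Fin n) ℂ)}
    (hN : ∀ M, N M = 0 → M = 0) {S : Matrix (Fin n) (Fin n) ℂ} {ρ : ℝ} (hρ : 0 ≤ ρ)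
    (hρ1 : ρ < 1) (hS : spectralRadius ℂ S = ENNReal.ofReal ρ)
    {Y : ℕ → Matrix (Fin n) (Fin n) ℂ} {L D : Matrix (Fin n) (Fin n) ℂ} {a b : ℝ}
    (ha : 0 ≤ a) (hYa : ∀ k, ‖Y k - L‖ ≤ a * ‖D * S ^ 2 ^ k‖)
    (hYb : ∀ k, ‖D * S ^ 2 ^ k‖ ≤ b * ‖Y k - L‖) :
    ConvergesQuadratically N Y L ρ := by
  obtain ⟨α, hα, β, hβ, hNα, hNβ⟩ := exists_seminorm_le_and_norm_le N hN
  obtain ⟨c, hc⟩ := exists_norm_mul_pow_two_mul_le D S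
  have hle : ∀ k, ‖Y k - L‖ ≤ a * ‖D‖ * ‖S ^ 2 ^ k‖ := fun k =>
    (hYa k).trans (by rw [mul_assoc]; gcongr; exact norm_mul_le _ _)
  refine ⟨?_, ⟨α * (a * (|c| * (|b| * β) ^ 2)), fun k => ?_⟩, ?_⟩
  · refine tendsto_iff_norm_sub_tendsto_zero.2 ?_
    refine squeeze_zero (fun _ => norm_nonneg _) hle ?_
    simpa using (tendsto_pow_two_pow_zero S hρ hρ1 hS).norm.const_mul (a * ‖D‖)
  · have h1 : ‖D * S ^ 2 ^ k‖ ≤ |b| * (β * N (Y k - L)) :=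
      (hYb k).trans (mul_le_mul (le_abs_self b) (hNβ _) (norm_nonneg _) (abs_nonneg b))
    have h2 : ‖D * S ^ 2 ^ (k + 1)‖ ≤ |c| * (|b| * (β * N (Y k - L))) ^ 2 := by
      rw [pow_succ' 2 k]
      refine (hc _).trans (mul_le_mul (le_abs_self c) ?_ (by positivity) (abs_nonneg c))
      gcongr
    calc N (Y (k + 1) - L) ≤ α * (a * ‖D * S ^ 2 ^ (k + 1)‖) :=
          (hNα _).trans (by gcongr; exact hYa _)
      _ ≤ α * (a * (|c| * (|b| * (β * N (Y k - L))) ^ 2)) := by gcongr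
      _ = _ := by ring
  -- The added `1` keeps the base positive when `D = 0`, so that its `2 ^ k`-th roots tend to `1`.
  · have hγ : 0 < α * (a * ‖D‖) + 1 := by positivity
    have hexp : Tendsto (fun k : ℕ => (1 / 2 ^ k : ℝ)) atTop (𝓝 0) := by
      simpa using tendsto_pow_atTop_nhds_zero_of_lt_one (r := (1 / 2 : ℝ)) (by norm_num)
        (by norm_num)
    have hlim : Tendsto (fun k : ℕ => (α * (a * ‖D‖) + 1) ^ (1 / 2 ^ k : ℝ) *
        ‖S ^ 2 ^ k‖ ^ (1 / 2 ^ k : ℝ)) atTop (𝓝 ρ) := by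
      simpa using ((Real.continuousAt_const_rpow hγ.ne').tendsto.comp hexp).mul
        (tendsto_norm_pow_two_pow_rpow S hρ hS)
    have hlim' := (continuous_coe_real_ereal.tendsto ρ).comp hlim
    rw [← hlim'.limsup_eq]
    refine limsup_le_limsup (Eventually.of_forall fun k => ?_)
    refine EReal.coe_le_coe_iff.2 ?_
    dsimp only
    rw [← Real.mul_rpow hγ.le (norm_nonneg _)]
    refine Real.rpow_le_rpow (apply_nonneg N _) ?_ (by positivity)
    calc N (Y k - L) ≤ α * (a * ‖D‖ * ‖S ^ 2 ^ k‖) :=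
          (hNα _).trans (by gcongr; exact hle k)
      _ ≤ (α * (a * ‖D‖) + 1) * ‖S ^ 2 ^ k‖ := by
          nlinarith [norm_nonneg (S ^ 2 ^ k)]

end Convergence

/-! ### The rate as a spectral radius -/

section SpectralRadius

variable {n : ℕ}

theorem isGreatest_moduli_and_spectralRadius (hn : 0 < n) {P B : Matrix (Fin n) (Fin n) ℂ}
    (h : InsideUnitCircle (pencilSpectrum P B)) :
    ∃ ρ : ℝ, IsGreatest (moduli (pencilSpectrum P B)) ρ ∧ ρ < 1 ∧
      spectralRadius ℂ (B⁻¹ * P) = ENNReal.ofReal ρ := by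
  let _ := Matrix.frobeniusNormedRing (m := Fin n) (α := ℂ)
  let _ := Matrix.frobeniusNormedAlgebra (m := Fin n) (R := ℂ) (α := ℂ)
  have : Nonempty (Fin n) := ⟨⟨0, hn⟩⟩
  have hB := det_ne_zero_of_insideUnitCircle h
  obtain ⟨z, hz, hzr⟩ := spectrum.exists_nnnorm_eq_spectralRadius (B⁻¹ * P)
  have hz' := (det_pencil_eq_zero_iff hB z).2 hz
  refine ⟨‖z‖, ⟨⟨z, coe_mem_pencilSpectrum.2 hz', rfl⟩, ?_⟩,
    norm_lt_one_of_insideUnitCircle h hz', ?_⟩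
  · rintro _ ⟨l, hl, rfl⟩
    have hl' := (det_pencil_eq_zero_iff hB l).1 (coe_mem_pencilSpectrum.1 hl)
    have : (‖l‖₊ : ENNReal) ≤ ‖z‖₊ := by
      rw [hzr]
      exact le_iSup₂ (f := fun l (_ : l ∈ spectrum ℂ (B⁻¹ * P)) => (‖l‖₊ : ENNReal)) l hl'
    exact_mod_cast this
  · rw [← hzr, ofReal_norm, enorm_eq_nnnorm]

end SpectralRadius

/-! ### Error bounds for the three sequences -/

section Convergence

attribute [local instance] Matrix.frobeniusNormedRing Matrix.frobeniusNormedAlgebra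

variable {n : ℕ} {s : StarKind} {A B C X S : Matrix (Fin n) (Fin n) ℂ}

theorem convergesQuadratically_iterates {N : Seminorm ℂ (Matrix (Fin n) (Fin n) ℂ)}
    (hN : ∀ M, N M = 0 → M = 0) {ρ : ℝ} (hρ : 0 ≤ ρ)
    (hρ1 : ρ < 1) (hSρ : spectralRadius ℂ S = ENNReal.ofReal ρ)
    (hsub : ∀ k : ℕ, IsUnit (1 - S ^ 2 ^ k)) (hK : IsUnit (K12 s A B))
    (hH : ∀ k, IsUnit (H12 s A B k)) (hHK : ∀ k, IsUnit (H12 s A B k + K12 s A B))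
    (hHS : ∀ k, H12 s A B k * (1 - S ^ 2 ^ k) = K12 s A B * (1 + S ^ 2 ^ k))
    (hX : A * X + s.op X * B = C) :
    ConvergesQuadratically N (Z12 s A B C) (-s.op A + B) ρ ∧
      ConvergesQuadratically N (Z21 s A B C) 0 ρ ∧
      ConvergesQuadratically N (Xk s A B C) X ρ := by
  obtain ⟨c, hc0, hc⟩ := exists_norm_one_sub_pow_le (tendsto_pow_two_pow_zero S hρ hρ1 hSρ)
  set K := K12 s A B with hKdef
  set D := (2 : ℂ) • K with hD
  have hKK : -s.op A + B = D := by
    rw [hD, hKdef, K12, smul_smul]; norm_num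
  have hDu : IsUnit D.det := by
    rw [hD, det_smul]
    exact (isUnit_iff_ne_zero.2 (pow_ne_zero _ (by norm_num))).mul ((isUnit_iff_isUnit_det _).1 hK)
  have hRdet : ∀ k : ℕ, IsUnit (1 - S ^ 2 ^ k).det := fun k =>
    (isUnit_iff_isUnit_det _).1 (hsub k)
  have hminus : ∀ k, (H12 s A B k - K) * (1 - S ^ 2 ^ k) = D * S ^ 2 ^ k := by
    intro k
    rw [sub_mul, hHS, hD, two_smul]
    noncomm_ring
  have hplus : ∀ k, (H12 s A B k + K) * (1 - S ^ 2 ^ k) = D := by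
    intro k
    rw [add_mul, hHS, hD, two_smul]
    noncomm_ring
  have hminus' : ∀ k, H12 s A B k - K = D * S ^ 2 ^ k * (1 - S ^ 2 ^ k)⁻¹ := by
    intro k
    rw [← hminus, mul_nonsing_inv_cancel_right _ _ (hRdet k)]
  have hEa : ∀ k, ‖H12 s A B k - K‖ ≤ c * ‖D * S ^ 2 ^ k‖ := by
    intro k
    rw [hminus', mul_comm c]
    refine (norm_mul_le _ _).trans ?_
    gcongr
    exact (hc k).2
  have hEb : ∀ k, ‖D * S ^ 2 ^ k‖ ≤ c * ‖H12 s A B k - K‖ := by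
    intro k
    rw [← hminus, mul_comm c]
    refine (norm_mul_le _ _).trans ?_
    gcongr
    exact (hc k).1
  have hZ12 : ∀ k, ‖Z12 s A B C k - (-s.op A + B)‖ = ‖H12 s A B k - K‖ := by
    intro k
    rw [Z12_eq, hKK, hD, two_smul]
    congr 1
    abel
  have hZ21 : ∀ k, ‖Z21 s A B C k - 0‖ = ‖H12 s A B k - K‖ := by
    intro k
    rw [sub_zero, Z21_eq, s.norm_op]
  have hDop : IsUnit (s.op D).det :=
    (isUnit_iff_isUnit_det _).1 (s.isUnit_op ((isUnit_iff_isUnit_det _).2 hDu))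
  have hopR : ∀ k : ℕ, IsUnit (s.op (1 - S ^ 2 ^ k)).det := fun k =>
    (isUnit_iff_isUnit_det _).1 (s.isUnit_op (hsub k))
  -- Multiplying by `D^⋆ = (1 - R)^⋆ (H₁₂ + K₁₂)^⋆` removes the inverse from the error formula, so
  -- it can be read in both directions.
  have hE : ∀ k, s.op D * (Xk s A B C k - X) =
      s.op (1 - S ^ 2 ^ k) * (s.op X * (H12 s A B k - K)) := by
    intro k
    rw [Xk_sub hX hH k (hHK k), ← hplus k, s.op_mul, mul_assoc,
      mul_nonsing_inv_cancel_left _ _ ((isUnit_iff_isUnit_det _).1 (s.isUnit_op (hHK k)))]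
  have hopinv : ∀ k : ℕ, s.op (1 - S ^ 2 ^ k)⁻¹ * s.op (1 - S ^ 2 ^ k) = 1 := by
    intro k
    rw [← s.op_mul, mul_nonsing_inv _ (hRdet k), s.op_one]
  have hXa : ∀ k, ‖Xk s A B C k - X‖ ≤
      (‖(s.op D)⁻¹‖ * (c * c)) * ‖s.op X * D * S ^ 2 ^ k‖ := by
    intro k
    have e : Xk s A B C k - X = (s.op D)⁻¹ * (s.op (1 - S ^ 2 ^ k) *
        (s.op X * D * S ^ 2 ^ k * (1 - S ^ 2 ^ k)⁻¹)) := by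
      rw [← nonsing_inv_mul_cancel_left (s.op D) (Xk s A B C k - X) hDop, hE, hminus']
      simp only [mul_assoc]
    rw [e]
    calc _ ≤ ‖(s.op D)⁻¹‖ * (‖s.op (1 - S ^ 2 ^ k)‖ *
          (‖s.op X * D * S ^ 2 ^ k‖ * ‖(1 - S ^ 2 ^ k)⁻¹‖)) := by
          refine (norm_mul_le _ _).trans ?_
          gcongr
          refine (norm_mul_le _ _).trans ?_
          gcongr
          exact norm_mul_le _ _
      _ ≤ ‖(s.op D)⁻¹‖ * (c * (‖s.op X * D * S ^ 2 ^ k‖ * c)) := by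
          rw [s.norm_op]
          gcongr
          exacts [(hc k).1, (hc k).2]
      _ = _ := by ring
  have hXb : ∀ k, ‖s.op X * D * S ^ 2 ^ k‖ ≤
      (c * c * ‖s.op D‖) * ‖Xk s A B C k - X‖ := by
    intro k
    have e : s.op X * D * S ^ 2 ^ k =
        s.op (1 - S ^ 2 ^ k)⁻¹ * (s.op D * (Xk s A B C k - X)) * (1 - S ^ 2 ^ k) := by
      rw [hE, ← mul_assoc, hopinv, one_mul, mul_assoc, mul_assoc, hminus]
    rw [e]
    calc _ ≤ ‖s.op (1 - S ^ 2 ^ k)⁻¹‖ * (‖s.op D‖ * ‖Xk s A B C k - X‖) *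
          ‖1 - S ^ 2 ^ k‖ := by
          refine (norm_mul_le _ _).trans ?_
          gcongr
          refine (norm_mul_le _ _).trans ?_
          gcongr
          exact norm_mul_le _ _
      _ ≤ c * (‖s.op D‖ * ‖Xk s A B C k - X‖) * c := by
          rw [s.norm_op]
          gcongr
          exacts [(hc k).2, (hc k).1]
      _ = _ := by ring
  exact ⟨convergesQuadratically_of_norm_le hN hρ hρ1 hSρ hc0
      (fun k => (hZ12 k).le.trans (hEa k)) (fun k => (hEb k).trans_eq (by rw [hZ12 k])),
    convergesQuadratically_of_norm_le hN hρ hρ1 hSρ hc0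
      (fun k => (hZ21 k).le.trans (hEa k)) (fun k => (hEb k).trans_eq (by rw [hZ21 k])),
    convergesQuadratically_of_norm_le hN hρ hρ1 hSρ (by positivity) hXa hXb⟩

end Convergence

end Palindromic

/-! ### Assembly of the theorem -/

open Palindromic
theorem mainTheorem2 {n : ℕ} (hn : 0 < n) (s : StarKind)
    (A B C X : Matrix (Fin n) (Fin n) ℂ)
    (hσ : InsideUnitCircle (pencilSpectrum A (s.op B)))
    (hX : IsStabilizingSolution s A B C X)
    (N : Seminorm ℂ (Matrix (Fin n) (Fin n) ℂ)) (hN : ∀ M, N M = 0 → M = 0) :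
    (∀ k, IsUnit (H12 s A B k) ∧ IsUnit (H12 s A B k + K12 s A B)) ∧
    ∃ ρ : ℝ, IsGreatest (moduli (pencilSpectrum A (s.op B))) ρ ∧ ρ < 1 ∧
      ConvergesQuadratically N (Z12 s A B C) (-s.op A + B) ρ ∧
      ConvergesQuadratically N (Z21 s A B C) 0 ρ ∧
      ConvergesQuadratically N (Xk s A B C) X ρ := by
  obtain ⟨hin, hXeq⟩ := hX
  obtain ⟨ρ, hρg, hρ1, hSρ⟩ := isGreatest_moduli_and_spectralRadius hn hin
  have hB := det_ne_zero_of_insideUnitCircle hin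
  have hBS : B * (B⁻¹ * s.op A) = s.op A :=
    mul_nonsing_inv_cancel_left _ _ (isUnit_iff_ne_zero.2 hB)
  have hρ : 0 ≤ ρ := by
    obtain ⟨l, -, rfl⟩ := hρg.1
    exact norm_nonneg l
  have hspec : ∀ l ∈ spectrum ℂ (B⁻¹ * s.op A), ‖l‖ < 1 := fun l hl =>
    norm_lt_one_of_insideUnitCircle hin ((det_pencil_eq_zero_iff hB l).2 hl)
  generalize B⁻¹ * s.op A = S at hSρ hBS hspec
  have hsub : ∀ k : ℕ, IsUnit (1 - S ^ 2 ^ k) := fun k =>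
    (isUnit_one_sub_pow_and_isUnit_one_add_pow hspec (by positivity)).1
  have hadd : ∀ k : ℕ, IsUnit (1 + S ^ 2 ^ k) := fun k =>
    (isUnit_one_sub_pow_and_isUnit_one_add_pow hspec (by positivity)).2
  have hKS : K12 s A B = (1 / 2 : ℂ) • (B * (1 - S)) := by
    rw [K12, ← hBS, mul_sub, mul_one, neg_add_eq_sub]
  -- `K₁₂ = B (1 - S) / 2`, and `1` is not an eigenvalue of `S`.
  have hK : IsUnit (K12 s A B) := by
    rw [hKS, isUnit_iff_isUnit_det, det_smul, det_mul]
    refine (isUnit_iff_ne_zero.2 (pow_ne_zero _ (by norm_num))).mul ((isUnit_iff_ne_zero.2 hB).mul ?_)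
    simpa using (isUnit_iff_isUnit_det _).1 (hsub 0)
  have hH := H12_mul_one_sub_pow hBS hadd hK
  have hHK : ∀ k, IsUnit (H12 s A B k + K12 s A B) := by
    intro k
    have e : (H12 s A B k + K12 s A B) * (1 - S ^ 2 ^ k) = (2 : ℂ) • K12 s A B := by
      rw [add_mul, (hH k).1, two_smul]
      noncomm_ring
    have hu : IsUnit ((2 : ℂ) • K12 s A B).det := by
      rw [det_smul]
      exact (isUnit_iff_ne_zero.2 (pow_ne_zero _ (by norm_num))).mul ((isUnit_iff_isUnit_det _).1 hK)
    rw [← e, det_mul] at hu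
    exact (isUnit_iff_isUnit_det _).2 (isUnit_of_mul_isUnit_left hu)
  refine ⟨fun k => ⟨(hH k).2, hHK k⟩, ρ, ?_, hρ1, ?_⟩
  · rwa [moduli_pencilSpectrum_op]
  · exact convergesQuadratically_iterates hN hρ hρ1 hSρ hsub hK (fun k => (hH k).2) hHK
      (fun k => (hH k).1) hXeq
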